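/- Let $G$ be a directed acyclic graph on a finite linearly ordered vertex set $V$. A trek from $i$ to $j$ is a simple path from $i$ to $j$ in the underlying undirected graph that contains no two distinct edges $k\to l$, $k'\to l$ with the same head; $T(i,j)$ is the set of treks from $i$ to $j$, and $\mathrm{top}(P)$ is the unique vertex of the trek $P$ that is not the head of an edge of $P$ (for $i=j$ the only trek is the empty one, with top $i$). Let $$\phi_G:\mathbb{C}[\sigma_{ij} \mid i\le j]\to\mathbb{C}[a_v,\lambda_{kl} \mid v\in V,\ k\to l\in E(G)],\qquad \sigma_{ij}\mapsto\sum_{P\in T(i,j)}a_{\mathrm{top}(P)}\prod_{k\to l\in P}\lambda_{kl},$$ and let $I_G=\ker\phi_G$, a homogeneous ideal. Its degree $\deg I_G$ is $Q(1)$, where the Hilbert series of $\mathbb{C}[\sigma_{ij}]/I_G$ is written as $Q(t)/(1-t)^D$ with $Q\in\mathbb{Z}[t]$ and $Q(1)\neq 0$. A downward directed tree is a directed acyclic graph whose underlying undirected graph is a tree, that has a unique sink, and all of whose edges point to that sink. A leaf of it is a source that is incident to exactly one edge. Let $T$ be a downward directed tree with sink $s$. Then $\deg I_T$ is well defined (a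 $Q$ as above exists), and it is determined recursively as follows. (a) If $T$ consists of a single vertex, then $\deg I_T=1$. (b) For every leaf $i$ of $T$ there is exactly one trek $P$ in $T(i,s)$, and $$\deg I_T=\sum_{k\to l\in P}\deg I_{T\setminus k\to l},$$ where $T\setminus k\to l$ is the forest obtained from $T$ by removing the edge $k\to l$ and keeping all vertices. Moreover, for every edge $k\to l$ of $P$, the connected components $T_k$ and $T_l$ of $T\setminus k\to l$ that contain $k$ and $l$ are downward directed trees with sinks $k$ and $s$, respectively, and $$\deg I_{T\setminus k\to l}=\deg I_{T_k}\cdot\deg I_{T_l}.$$ -/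

import Mathlib

noncomputable section

/-! ### Degree of a homogeneous ideal -/

namespace HilbertDegree

variable {K τ : Type*} [Field K]

/-- The Hilbert function of `K[τ]/I` for a homogeneous ideal `I`: the dimension over `K` of the
degree `d` part of the quotient, i.e. of the image of the forms of degree `d`. -/
def hilbertFunction (I : Ideal (MvPolynomial τ K)) (d : ℕ) : ℕ :=
  Module.finrank K
    ((MvPolynomial.homogeneousSubmodule τ K d).map (Ideal.Quotient.mkₐ K I).toLinearMap)

/-- The Hilbert series of `K[τ]/I`. -/
def hilbertSeries (I : Ideal (MvPolynomial τ K)) : PowerSeries ℤ :=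
  PowerSeries.mk fun d => (hilbertFunction I d : ℤ)

/-- `e` is the degree of the homogeneous ideal `I`: the Hilbert series of `K[τ]/I` can be written
`Q(t) / (1 - t) ^ D` with an integer polynomial `Q` such that `Q(1) = e ≠ 0`. -/
def HasDegree (I : Ideal (MvPolynomial τ K)) (e : ℤ) : Prop :=
  ∃ (D : ℕ) (Q : Polynomial ℤ),
    hilbertSeries I * (1 - PowerSeries.X) ^ D = (Q : PowerSeries ℤ) ∧ Q.eval 1 = e ∧ e ≠ 0

theorem HasDegree.unique {I : Ideal (MvPolynomial τ K)} {e e' : ℤ}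
    (h : HasDegree I e) (h' : HasDegree I e') : e = e' := by
  obtain ⟨D, Q, hQ, he, hne⟩ := h
  obtain ⟨D', Q', hQ', he', hne'⟩ := h'
  have key : Q * (1 - Polynomial.X) ^ D' = Q' * (1 - Polynomial.X) ^ D := by
    apply Polynomial.coe_injective ℤ
    push_cast
    rw [← hQ, ← hQ']
    ring
  rcases lt_trichotomy D D' with hlt | rfl | hlt
  · obtain ⟨c, rfl⟩ := Nat.exists_eq_add_of_lt hlt
    have h0 : (1 - Polynomial.X : Polynomial ℤ) ^ D ≠ 0 :=
      pow_ne_zero _ fun h => by simpa using congrArg (Polynomial.eval 0) h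
    have h1 : Q * (1 - Polynomial.X) ^ (c + 1) = Q' := by
      apply mul_right_cancel₀ h0
      rw [← key]
      ring
    have h2 := congrArg (Polynomial.eval 1) h1
    simp at h2
    omega
  · have h0 : (1 - Polynomial.X : Polynomial ℤ) ^ D ≠ 0 :=
      pow_ne_zero _ fun h => by simpa using congrArg (Polynomial.eval 0) h
    have := mul_right_cancel₀ h0 key
    rw [← he, ← he', this]
  · obtain ⟨c, rfl⟩ := Nat.exists_eq_add_of_lt hlt
    have h0 : (1 - Polynomial.X : Polynomial ℤ) ^ D' ≠ 0 :=
      pow_ne_zero _ fun h => by simpa using congrArg (Polynomial.eval 0) h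
    have h1 : Q' * (1 - Polynomial.X) ^ (c + 1) = Q := by
      apply mul_right_cancel₀ h0
      rw [key]
      ring
    have h2 := congrArg (Polynomial.eval 1) h1
    simp at h2
    omega

open Classical in
/-- The degree of a homogeneous ideal (`0` if the Hilbert series is not of the required form, as
for the unit ideal). -/
def degree (I : Ideal (MvPolynomial τ K)) : ℤ :=
  if h : ∃ e, HasDegree I e then h.choose else 0

end HilbertDegree

/-! ### Directed graphs, treks, and the ideal of a Gaussian Bayesian network -/

namespace BayesNet

variable {V : Type*}

/-- The underlying undirected graph. -/
abbrev skeleton (G : Digraph V) : SimpleGraph V := G.toSimpleGraphInclusive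

/-- Directed acyclic graphs. -/
def IsDAG (G : Digraph V) : Prop := ∀ v, ¬ Relation.TransGen G.Adj v v

/-- A tree is a directed acyclic graph whose underlying undirected graph is a tree. -/
def IsDirTree (G : Digraph V) : Prop := IsDAG G ∧ (skeleton G).IsTree

/-- A sink: a vertex with no outgoing edges. -/
def IsSink (G : Digraph V) (v : V) : Prop := ∀ w, ¬ G.Adj v w

/-- A source: a vertex with no incoming edges. -/
def IsSource (G : Digraph V) (v : V) : Prop := ∀ u, ¬ G.Adj u v

/-- `G` is a downward directed tree with sink `s`: a tree with `s` as its unique sink, all of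
whose edges point to `s`. -/
structure IsDownwardTree (G : Digraph V) (s : V) : Prop where
  isDirTree : IsDirTree G
  isSink_iff : ∀ v, IsSink G v ↔ v = s
  toSink : ∀ k l, G.Adj k l → Relation.ReflTransGen G.Adj l s

/-- A leaf of a downward directed tree: a source that is incident to exactly one edge. -/
def IsLeaf (G : Digraph V) (i : V) : Prop := IsSource G i ∧ ∃! k, (skeleton G).Adj i k

/-- The directed edges `k → l` of `G`, as pairs `(k, l)`. -/
abbrev Edge (G : Digraph V) : Type _ := {e : V × V // G.Adj e.1 e.2}

/-- `G ∖ k → l`: the edge `e = (k, l)` is removed, all vertices are kept. -/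
def deleteEdge (G : Digraph V) (e : V × V) : Digraph V where
  Adj u v := G.Adj u v ∧ (u, v) ≠ e

/-- The connected component of the vertex `v`, as a directed graph on its own vertex set. -/
def component (G : Digraph V) (v : V) : Digraph {w : V // (skeleton G).Reachable v w} where
  Adj u w := G.Adj u.1 w.1

/-- The directed edge `k → l` of `G` is used (in either direction) by the walk `p`. -/
def Uses (G : Digraph V) {i j : V} (p : (skeleton G).Walk i j) (k l : V) : Prop :=
  G.Adj k l ∧ s(k, l) ∈ p.edges

/-- `T(i, j)`: the simple paths from `i` to `j` in the underlying graph without a collider, i.e.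
without two different edges `k → l`, `k' → l` with the same head. -/
def Trek (G : Digraph V) (i j : V) : Type _ :=
  {p : (skeleton G).Path i j // ∀ k k' l, Uses G p.1 k l → Uses G p.1 k' l → k = k'}

/-- The edges of a trek. -/
def Trek.edges [Finite V] {G : Digraph V} {i j : V} (P : Trek G i j) : Finset (Edge G) :=
  (Set.toFinite {e : Edge G | Uses G P.1.1 e.1.1 e.1.2}).toFinset

/-- The topmost vertex of a trek: its unique vertex that is not the head of an edge of the
trek. -/
def Trek.top {G : Digraph V} {i j : V} (P : Trek G i j) : V :=
  @Classical.epsilon V ⟨i⟩ fun v => v ∈ P.1.1.support ∧ ∀ u, ¬ Uses G P.1.1 u v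

/-- The index set of the indeterminates `σ_{ij}`, `i ≤ j`. -/
abbrev SigmaIndex (V : Type*) [LinearOrder V] : Type _ := {p : V × V // p.1 ≤ p.2}

/-- The ring homomorphism `φ_G`, sending `σ_{ij}` to the sum over the treks `P` in `T(i, j)` of
`a_{top(P)} ∏_{k → l ∈ P} λ_{kl}`. The indeterminates of the target are `a_v` (index `Sum.inl v`)
and `λ_e` (index `Sum.inr e`). -/
def trekHom [Finite V] [LinearOrder V] (G : Digraph V) :
    MvPolynomial (SigmaIndex V) ℂ →ₐ[ℂ] MvPolynomial (V ⊕ Edge G) ℂ :=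
  MvPolynomial.aeval fun p =>
    ∑ᶠ P : Trek G p.1.1 p.1.2,
      MvPolynomial.X (Sum.inl P.top) * ∏ e ∈ P.edges, MvPolynomial.X (Sum.inr e)

/-- There are only finitely many treks, so the sum in `trekHom` is a genuine finite sum. -/
instance [Finite V] (G : Digraph V) (i j : V) : Finite (Trek G i j) := by
  classical
  have := Fintype.ofFinite V
  exact Subtype.finite

/-- The ideal `I_G = ker φ_G`. -/
def bayesIdeal [Finite V] [LinearOrder V] (G : Digraph V) :
    Ideal (MvPolynomial (SigmaIndex V) ℂ) :=
  RingHom.ker (trekHom G)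

end BayesNet

end

noncomputable section

/-! ### Hilbert functions of kernels of monomial maps -/

/-! In a downward tree every vertex has at most one outgoing edge (`IsDownwardTree.isForest`), so a
trek is a directed walk read in one of its two directions (`IsForest.reaches_or_reaches_of_walk`),
and `φ` sends each variable to a monomial or to 0. The Hilbert function in degree `d` therefore
counts the distinct sums of `d` trek exponents (`hilbertFunction_ker_aeval`). Record such a sum as a
pair `(α, y)`, with `α v` the exponent of `a_v` and `y v` that of the edge leaving `v`. By flow
decomposition (`IsForest.flows_eq_iterSums`), the pairs that occur are the lattice points with `∑ α
= d`, `y = 0` at sinks and `y v ≤ α v + inflow v`.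

Let a source `i` reach a sink `t` by a nontrivial walk. Adding the unit flow along it injects degree
`d` into degree `d + 1` and misses exactly the flows vanishing on some edge of the walk, so `1 - X`
times the flow series counts those (`IsForest.flowSeries_mul_one_sub`). Flows vanishing on the edge
leaving `k` are the flows of the graph without that edge. Its pole order at 1, the number of
vertices plus the number of non-sinks, is lower by one; overlaps for two edges lie lower still, so
inclusion-exclusion leaves the sum of the leading coefficients (`IsForest.hasPole_blockedSeries`).
Induction makes these positive, so the degree exists. Flow constraints decouple over components,
which gives the product formula (`IsForest.flowSeries_eq_mul`). -/

/-- Sums of `d` elements of `U`. -/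
def iterSums {M : Type*} [AddCommMonoid M] (U : Set M) : ℕ → Set M
  | 0 => {0}
  | d + 1 => Set.image2 (· + ·) (iterSums U d) U

theorem finite_iterSums {M : Type*} [AddCommMonoid M] {U : Set M} (hU : U.Finite) (d : ℕ) :
    (iterSums U d).Finite := by
  induction d with
  | zero => exact Set.finite_singleton _
  | succ d ih => exact ih.image2 _ hU

theorem image_iterSums {M N : Type*} [AddCommMonoid M] [AddCommMonoid N] (f : M →+ N) (U : Set M)
    (d : ℕ) : f '' iterSums U d = iterSums (f '' U) d := by
  induction d with
  | zero => simp [iterSums]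
  | succ d ih =>
    simp only [iterSums, ← ih]
    exact Set.image_image2_distrib (map_add f)

namespace HilbertDegree

open MvPolynomial

open scoped Pointwise in
theorem monomial_image_pow {K ρ : Type*} [Field K] (U : Set (ρ →₀ ℕ)) (d : ℕ) :
    ((fun u => monomial u (1 : K)) '' U) ^ d = (fun u => monomial u (1 : K)) '' iterSums U d := by
  induction d with
  | zero => simp [iterSums, Set.singleton_one]
  | succ d ih =>
    rw [pow_succ, ih, iterSums, ← Set.image2_mul]
    exact (Set.image_image2_distrib fun u v => by simp [monomial_mul]).symm

theorem finrank_span_monomial {K ρ : Type*} [Field K] (U : Set (ρ →₀ ℕ)) :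
    Module.finrank K (Submodule.span K ((fun u => monomial u (1 : K)) '' U)) = U.ncard := by
  have hinj : Function.Injective fun u : ρ →₀ ℕ => monomial u (1 : K) :=
    monomial_left_injective one_ne_zero
  have hli : LinearIndependent K fun u : ρ →₀ ℕ => monomial u (1 : K) := by
    simpa using (basisMonomials ρ K).linearIndependent
  have h := rank_span_set (hli.linearIndepOn_id.mono (Set.image_subset_range _ U))
  rw [Module.finrank, h, ← Set.ncard_image_of_injective U hinj]
  rfl

/-- Forms of degree `d` are the `d`-th power of the span of the variables, and powers commute with
algebra maps and with spans. Comparing spans only lets `f` repeat values or take the value 0. -/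
theorem hilbertFunction_ker_aeval {K τ ρ : Type*} [Field K] (f : τ → MvPolynomial ρ K)
    (U : Set (ρ →₀ ℕ))
    (hU : Submodule.span K (Set.range f) =
      Submodule.span K ((fun u => monomial u (1 : K)) '' U)) (d : ℕ) :
    hilbertFunction (RingHom.ker (aeval f : MvPolynomial τ K →ₐ[K] MvPolynomial ρ K)) d =
      (iterSums U d).ncard := by
  set φ : MvPolynomial τ K →ₐ[K] MvPolynomial ρ K := aeval f
  have hmap : (homogeneousSubmodule τ K d).map φ.toLinearMap =
      Submodule.span K ((fun u => monomial u (1 : K)) '' iterSums U d) := by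
    rw [← homogeneousSubmodule_one_pow, Submodule.map_pow, homogeneousSubmodule_one_eq_span_X,
      Submodule.map_span, ← Set.range_comp, ← monomial_image_pow, ← Submodule.span_pow, ← hU]
    congr 3
    ext
    simp [φ]
  rw [← finrank_span_monomial (K := K), ← hmap, hilbertFunction]
  -- The quotient by the kernel embeds in the target, so the dimension can be computed there.
  have hinj : Function.Injective (Ideal.kerLiftAlg φ) := Ideal.kerLiftAlg_injective φ
  have hcomp : (Ideal.kerLiftAlg φ).toLinearMap ∘ₗ
      (Ideal.Quotient.mkₐ K (RingHom.ker φ)).toLinearMap = φ.toLinearMap :=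
    LinearMap.ext fun x => Ideal.kerLiftAlg_mk φ x
  rw [← hcomp, Submodule.map_comp]
  exact (Submodule.equivMapOfInjective (Ideal.kerLiftAlg φ).toLinearMap hinj _).finrank_eq

theorem HasDegree.degree_eq {K τ : Type*} [Field K] {I : Ideal (MvPolynomial τ K)} {e : ℤ}
    (h : HasDegree I e) : degree I = e := by
  have hex : ∃ e, HasDegree I e := ⟨e, h⟩
  rw [degree, dif_pos hex]
  exact hex.choose_spec.unique h

end HilbertDegree

/-! ### Poles at `1` -/

/-- The power series `f` equals `Q / (1 - X) ^ D` for a polynomial `Q` with `Q(1) = e`. -/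
def HasPole (f : PowerSeries ℤ) (D : ℕ) (e : ℤ) : Prop :=
  ∃ Q : Polynomial ℤ, f * (1 - PowerSeries.X) ^ D = (Q : PowerSeries ℤ) ∧ Q.eval 1 = e

namespace HasPole

variable {f g : PowerSeries ℤ} {D D' : ℕ} {e e' : ℤ}

theorem zero (D : ℕ) : HasPole 0 D 0 := ⟨0, by simp, by simp⟩

theorem add (hf : HasPole f D e) (hg : HasPole g D e') : HasPole (f + g) D (e + e') := by
  obtain ⟨P, hP, rfl⟩ := hf
  obtain ⟨Q, hQ, rfl⟩ := hg
  exact ⟨P + Q, by rw [add_mul, hP, hQ, Polynomial.coe_add], by simp⟩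

theorem sub (hf : HasPole f D e) (hg : HasPole g D e') : HasPole (f - g) D (e - e') := by
  obtain ⟨P, hP, rfl⟩ := hf
  obtain ⟨Q, hQ, rfl⟩ := hg
  exact ⟨P - Q, by rw [sub_mul, hP, hQ, Polynomial.coe_sub], by simp⟩

theorem mul (hf : HasPole f D e) (hg : HasPole g D' e') : HasPole (f * g) (D + D') (e * e') := by
  obtain ⟨P, hP, rfl⟩ := hf
  obtain ⟨Q, hQ, rfl⟩ := hg
  exact ⟨P * Q, by rw [Polynomial.coe_mul, ← hP, ← hQ]; ring, by simp⟩

/-- A surplus factor `1 - X` vanishes at 1. This is how terms of lower pole order drop out of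
leading coefficients. -/
theorem succ (hf : HasPole f D e) : HasPole f (D + 1) 0 := by
  obtain ⟨P, hP, rfl⟩ := hf
  refine ⟨P * (1 - Polynomial.X), ?_, by simp⟩
  rw [Polynomial.coe_mul, ← hP]
  push_cast
  ring

theorem of_mul (hf : HasPole (f * (1 - PowerSeries.X)) D e) : HasPole f (D + 1) e := by
  obtain ⟨P, hP, rfl⟩ := hf
  exact ⟨P, by rw [← hP]; ring, rfl⟩

theorem hasDegree {K τ : Type*} [Field K] {I : Ideal (MvPolynomial τ K)}
    (h : HasPole (HilbertDegree.hilbertSeries I) D e) (he : e ≠ 0) :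
    HilbertDegree.HasDegree I e := by
  obtain ⟨Q, hQ, hQe⟩ := h
  exact ⟨D, Q, hQ, hQe, he⟩

end HasPole

end

noncomputable section

/-! ### Flows on directed forests -/

namespace BayesNet

open Relation

variable {V : Type*}

/-- Directed forests in which every vertex has at most one outgoing edge. -/
structure IsForest (G : Digraph V) : Prop where
  dag : IsDAG G
  rightUnique : Relator.RightUnique G.Adj
  acyclic : (skeleton G).IsAcyclic

namespace IsForest

variable {G : Digraph V} {u v w : V}

theorem not_reaches_of_adj (hG : IsForest G) (h : G.Adj u v) : ¬ ReflTransGen G.Adj v u :=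
  fun h' => hG.dag u (TransGen.head' h h')

theorem reaches_of_transGen (hG : IsForest G) (h : G.Adj u v) (h' : TransGen G.Adj u w) :
    ReflTransGen G.Adj v w := by
  obtain ⟨x, hx, hxw⟩ := TransGen.head'_iff.1 h'
  rwa [hG.rightUnique h hx]

/-- The vertices reached from `i` form a chain. If one of `u`, `u'` properly preceded the other, its
walk would pass through `v` and close a directed cycle. -/
theorem eq_of_reaches_of_adj (hG : IsForest G) {i u' : V} (h : ReflTransGen G.Adj i u)
    (h' : ReflTransGen G.Adj i u') (huv : G.Adj u v) (huv' : G.Adj u' v) : u = u' := by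
  rcases ReflTransGen.total_of_right_unique hG.rightUnique h h' with hu | hu <;>
    rcases reflTransGen_iff_eq_or_transGen.1 hu with rfl | ht
  · rfl
  · exact absurd (hG.reaches_of_transGen huv ht) (hG.not_reaches_of_adj huv')
  · rfl
  · exact absurd (hG.reaches_of_transGen huv' ht) (hG.not_reaches_of_adj huv)

theorem wellFounded_transGen [Finite V] (hG : IsForest G) : WellFounded (TransGen G.Adj) :=
  haveI : Std.Irrefl (TransGen G.Adj) := ⟨hG.dag⟩
  Finite.wellFounded_of_trans_of_irrefl _

theorem wellFounded_flip_transGen [Finite V] (hG : IsForest G) :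
    WellFounded (flip (TransGen G.Adj)) :=
  haveI : Std.Irrefl (flip (TransGen G.Adj)) := ⟨hG.dag⟩
  haveI : IsTrans V (flip (TransGen G.Adj)) := ⟨fun _ _ _ h h' => TransGen.trans h' h⟩
  Finite.wellFounded_of_trans_of_irrefl _

theorem exists_source [Finite V] (hG : IsForest G) (v : V) :
    ∃ i, IsSource G i ∧ ReflTransGen G.Adj i v := by
  induction v using hG.wellFounded_transGen.induction with
  | _ v ih =>
    by_cases hv : IsSource G v
    · exact ⟨v, hv, .refl⟩
    · simp only [IsSource, not_forall, not_not] at hv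
      obtain ⟨u, hu⟩ := hv
      obtain ⟨i, hi, hiu⟩ := ih u (.single hu)
      exact ⟨i, hi, hiu.tail hu⟩

theorem exists_sink [Finite V] (hG : IsForest G) (v : V) :
    ∃ t, IsSink G t ∧ ReflTransGen G.Adj v t := by
  induction v using hG.wellFounded_flip_transGen.induction with
  | _ v ih =>
    by_cases hv : IsSink G v
    · exact ⟨v, hv, .refl⟩
    · simp only [IsSink, not_forall, not_not] at hv
      obtain ⟨u, hu⟩ := hv
      obtain ⟨i, hi, hiu⟩ := ih u (.single hu)
      exact ⟨i, hi, hiu.head hu⟩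

end IsForest

/-- A sink is not the start of a nontrivial directed walk. -/
theorem IsSink.not_transGen {G : Digraph V} {t v : V} (ht : IsSink G t) :
    ¬ TransGen G.Adj t v := fun h => by
  obtain ⟨x, hx, -⟩ := TransGen.head'_iff.1 h
  exact ht x hx

theorem IsSink.eq_of_reaches {G : Digraph V} {t v : V} (ht : IsSink G t)
    (h : ReflTransGen G.Adj t v) : v = t :=
  (reflTransGen_iff_eq_or_transGen.1 h).resolve_right ht.not_transGen

open Classical in
/-- The amount of flow `y` entering the vertex `v`, where `y u` is the flow leaving `u`. -/
def inflow [Fintype V] (G : Digraph V) (y : V → ℕ) (v : V) : ℕ :=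
  ∑ u, if G.Adj u v then y u else 0

theorem inflow_add [Fintype V] (G : Digraph V) (y z : V → ℕ) (v : V) :
    inflow G (y + z) v = inflow G y v + inflow G z v := by
  simp only [inflow, ← Finset.sum_add_distrib]
  refine Finset.sum_congr rfl fun u _ => ?_
  split_ifs <;> simp

theorem inflow_eq_zero [Fintype V] {G : Digraph V} {y : V → ℕ} {v : V}
    (h : ∀ u, G.Adj u v → y u = 0) : inflow G y v = 0 := by
  classical
  refine Finset.sum_eq_zero fun u _ => ?_
  split_ifs with hu
  · exact h u hu
  · rfl

theorem le_inflow [Fintype V] {G : Digraph V} (y : V → ℕ) {u v : V} (h : G.Adj u v) :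
    y u ≤ inflow G y v := by
  classical
  rw [inflow, ← Finset.add_sum_erase _ _ (Finset.mem_univ u), if_pos h]
  exact Nat.le_add_right _ _

theorem inflow_congr [Fintype V] {G H : Digraph V} {y z : V → ℕ} {v : V}
    (h : ∀ u, G.Adj u v ∧ y u ≠ 0 ∨ H.Adj u v ∧ z u ≠ 0 → (G.Adj u v ∧ H.Adj u v ∧ y u = z u)) :
    inflow G y v = inflow H z v := by
  classical
  refine Finset.sum_congr rfl fun u _ => ?_
  have := h u
  by_cases hG : G.Adj u v <;> by_cases hH : H.Adj u v <;> by_cases hy : y u = 0 <;>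
    by_cases hz : z u = 0 <;> simp_all

/-- Pairs `(α, y)` where the sources `α` have total amount `d`, and the flow `y` along the edges
(`y v` being the flow leaving `v`) never exceeds what is available. -/
def flows [Fintype V] (G : Digraph V) (d : ℕ) : Set ((V → ℕ) × (V → ℕ)) :=
  {w | ∑ v, w.1 v = d ∧ (∀ v, IsSink G v → w.2 v = 0) ∧ ∀ v, w.2 v ≤ w.1 v + inflow G w.2 v}

open Classical in
/-- The flow of one unit along the directed walk from `i` to `j`. -/
def unitFlow (G : Digraph V) (i j : V) : (V → ℕ) × (V → ℕ) :=
  (Pi.single i 1, fun v => if ReflTransGen G.Adj i v ∧ TransGen G.Adj v j then 1 else 0)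

theorem add_mem_flows [Fintype V] {G : Digraph V} {d d' : ℕ} {w w' : (V → ℕ) × (V → ℕ)}
    (h : w ∈ flows G d) (h' : w' ∈ flows G d') : w + w' ∈ flows G (d + d') := by
  refine ⟨?_, fun v hv => ?_, fun v => ?_⟩
  · rw [← h.1, ← h'.1, ← Finset.sum_add_distrib]
    rfl
  · simp [h.2.1 v hv, h'.2.1 v hv]
  · have h1 := h.2.2 v
    have h2 := h'.2.2 v
    simp only [Prod.fst_add, Prod.snd_add, Pi.add_apply, inflow_add]
    omega

open Classical in
-- A vertex other than `i` reached from `i` has exactly one predecessor reached from `i`, and `i`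
-- itself has none.
theorem IsForest.single_add_inflow [Fintype V] {G : Digraph V} (hG : IsForest G) (i v : V) :
    (if v = i then 1 else 0) + inflow G (fun u => if ReflTransGen G.Adj i u then 1 else 0) v =
      if ReflTransGen G.Adj i v then 1 else 0 := by
  by_cases hvi : v = i
  · subst hvi
    rw [inflow_eq_zero]
    · simp [ReflTransGen.refl]
    · intro u hu
      exact if_neg (hG.not_reaches_of_adj hu)
  · rw [if_neg hvi, zero_add]
    by_cases hv : ReflTransGen G.Adj i v
    · obtain hv' | ⟨u, hiu, huv⟩ := ReflTransGen.cases_tail_iff _ _ _ |>.1 hv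
      · exact absurd hv' hvi
      · rw [if_pos hv, inflow, Finset.sum_eq_single u]
        · simp [huv, hiu]
        · intro b _ hbu
          split_ifs with h1 h2
          · exact absurd (hG.eq_of_reaches_of_adj h2 hiu h1 huv) hbu
          · rfl
          · rfl
        · simp
    · rw [if_neg hv, inflow_eq_zero]
      intro u hu
      exact if_neg fun h => hv (h.tail hu)

open Classical in
-- Kirchhoff's law. At vertices that reach `j` the inflow is that of the whole set reached from `i`;
-- elsewhere all terms vanish.
theorem IsForest.unitFlow_conservation [Fintype V] {G : Digraph V} (hG : IsForest G) {i j : V}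
    (hij : ReflTransGen G.Adj i j) (v : V) :
    (unitFlow G i j).1 v + inflow G (unitFlow G i j).2 v =
      (unitFlow G i j).2 v + if v = j then 1 else 0 := by
  simp only [unitFlow, Pi.single_apply]
  by_cases hvj : ReflTransGen G.Adj v j
  · have : inflow G (fun v => if ReflTransGen G.Adj i v ∧ TransGen G.Adj v j then 1 else 0) v =
        inflow G (fun u => if ReflTransGen G.Adj i u then 1 else 0) v := by
      refine inflow_congr fun u hu => ?_
      have huv : G.Adj u v := by tauto
      have : TransGen G.Adj u j := TransGen.head' huv hvj
      simp [huv, this]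
    rw [this, hG.single_add_inflow]
    by_cases hv : v = j
    · subst hv
      simp [hij, hG.dag v]
    · have := (reflTransGen_iff_eq_or_transGen.1 hvj).resolve_left (Ne.symm hv)
      simp [hv, this]
  · rw [inflow_eq_zero]
    · have h1 : v ≠ i := by rintro rfl; exact hvj hij
      have h2 : v ≠ j := by rintro rfl; exact hvj .refl
      have h3 : ¬ TransGen G.Adj v j := fun h => hvj h.to_reflTransGen
      simp [h1, h2, h3]
    · intro u hu
      exact if_neg fun h => hvj (hG.reaches_of_transGen hu h.2)

theorem IsForest.unitFlow_mem_flows [Fintype V] {G : Digraph V} (hG : IsForest G) {i j : V}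
    (hij : ReflTransGen G.Adj i j) : unitFlow G i j ∈ flows G 1 := by
  classical
  refine ⟨by simp [unitFlow], fun v hv => ?_, fun v => ?_⟩
  · exact if_neg fun h => hv.not_transGen h.2
  · rw [hG.unitFlow_conservation hij]
    exact Nat.le_add_right _ _

/-- By conservation, subtracting the unit flow leaves the slack `α + inflow - y` unchanged except at
`j`, where it drops by one; hence `hj`. -/
theorem IsForest.exists_eq_add_unitFlow [Fintype V] {G : Digraph V} (hG : IsForest G) {i j : V}
    (hij : ReflTransGen G.Adj i j) {d : ℕ} {w : (V → ℕ) × (V → ℕ)} (hw : w ∈ flows G (d + 1))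
    (hi : 0 < w.1 i)
    (hpath : ∀ u, ReflTransGen G.Adj i u → TransGen G.Adj u j → 0 < w.2 u)
    (hj : w.2 j < w.1 j + inflow G w.2 j) : ∃ w' ∈ flows G d, w' + unitFlow G i j = w := by
  classical
  have hle : unitFlow G i j ≤ w := by
    constructor
    · intro v
      by_cases hv : v = i
      · subst hv
        simpa [unitFlow] using Nat.succ_le_of_lt hi
      · simp [unitFlow, hv]
    · intro v
      simp only [unitFlow]
      split_ifs with h
      · exact hpath v h.1 h.2
      · exact Nat.zero_le _
  obtain ⟨w', rfl⟩ := exists_add_of_le hle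
  rw [add_comm] at hw hj ⊢
  refine ⟨w', ⟨?_, fun v hv => ?_, fun v => ?_⟩, rfl⟩
  · have h1 := hw.1
    have h2 := (hG.unitFlow_mem_flows hij).1
    simp only [Prod.fst_add, Pi.add_apply, Finset.sum_add_distrib, h2] at h1
    omega
  · have := hw.2.1 v hv
    simp only [Prod.snd_add, Pi.add_apply] at this
    omega
  · have h1 := hw.2.2 v
    have h2 := hG.unitFlow_conservation hij v
    simp only [Prod.fst_add, Prod.snd_add, Pi.add_apply, inflow_add] at h1 hj
    split_ifs at h2 with hv
    · subst hv
      omega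
    · omega

/-- Follow the flow downwards: a vertex without slack passes on everything it has. This stops at a
sink at the latest, since nothing leaves a sink. -/
theorem IsForest.exists_outlet [Fintype V] {G : Digraph V} (hG : IsForest G) {d : ℕ}
    {w : (V → ℕ) × (V → ℕ)} (hw : w ∈ flows G d) (v : V) (hv : 0 < w.1 v + inflow G w.2 v) :
    ∃ j, ReflTransGen G.Adj v j ∧
      (∀ u, ReflTransGen G.Adj v u → TransGen G.Adj u j → 0 < w.2 u) ∧
      w.2 j < w.1 j + inflow G w.2 j := by
  induction v using hG.wellFounded_flip_transGen.induction with
  | _ v ih =>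
    rcases (hw.2.2 v).lt_or_eq with hlt | heq
    · exact ⟨v, .refl, fun u hvu huv => absurd (huv.trans_left hvu) (hG.dag u), hlt⟩
    · have hns : ¬ IsSink G v := fun h => by
        have := hw.2.1 v h
        omega
      simp only [IsSink, not_forall, not_not] at hns
      obtain ⟨x, hx⟩ := hns
      have hle := le_inflow w.2 hx
      obtain ⟨j, hj, hpath, hout⟩ := ih x (.single hx) (by omega)
      refine ⟨j, hj.head hx, fun u hvu huj => ?_, hout⟩
      rcases ReflTransGen.cases_head hvu with rfl | ⟨x', hx', hx'u⟩
      · omega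
      · rw [← hG.rightUnique hx hx'] at hx'u
        exact hpath u hx'u huj

theorem IsForest.flows_zero [Fintype V] {G : Digraph V} (hG : IsForest G) :
    flows G 0 = {0} := by
  ext w
  refine ⟨fun hw => ?_, ?_⟩
  · have h1 : ∀ v, w.1 v = 0 := fun v => by simpa using (Finset.sum_eq_zero_iff.1 hw.1) v
    have h2 : ∀ v, w.2 v = 0 := fun v => by
      induction v using hG.wellFounded_transGen.induction with
      | _ v ih =>
        have := hw.2.2 v
        rw [h1, inflow_eq_zero fun u hu => ih u (.single hu)] at this
        omega
    exact Prod.ext (funext h1) (funext h2)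
  · rintro rfl
    exact ⟨by simp, fun _ _ => rfl, fun _ => Nat.zero_le _⟩

/-- The unit flows along all directed walks. -/
def unitFlows (G : Digraph V) : Set ((V → ℕ) × (V → ℕ)) :=
  {w | ∃ i j, ReflTransGen G.Adj i j ∧ unitFlow G i j = w}

/-- Greedy flow decomposition: start at a vertex with positive supply, follow the flow to an outlet,
and subtract that walk. -/
theorem IsForest.flows_eq_iterSums [Fintype V] {G : Digraph V} (hG : IsForest G) (d : ℕ) :
    flows G d = iterSums (unitFlows G) d := by
  induction d with
  | zero => exact hG.flows_zero
  | succ d ih =>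
    rw [iterSums, ← ih]
    ext w
    constructor
    · intro hw
      obtain ⟨i, hi⟩ : ∃ i, 0 < w.1 i := by
        by_contra! h
        have := hw.1
        rw [Finset.sum_eq_zero fun v _ => Nat.le_zero.1 (h v)] at this
        omega
      obtain ⟨j, hij, hpath, hj⟩ := hG.exists_outlet hw i (by omega)
      obtain ⟨w', hw', rfl⟩ := hG.exists_eq_add_unitFlow hij hw hi hpath hj
      exact ⟨w', hw', _, ⟨i, j, hij, rfl⟩, rfl⟩
    · rintro ⟨w', hw', _, ⟨i, j, hij, rfl⟩, rfl⟩
      exact add_mem_flows hw' (hG.unitFlow_mem_flows hij)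

theorem finite_unitFlows [Finite V] (G : Digraph V) : (unitFlows G).Finite := by
  refine (Set.finite_range fun p : V × V => unitFlow G p.1 p.2).subset ?_
  rintro _ ⟨i, j, -, rfl⟩
  exact ⟨(i, j), rfl⟩

theorem IsForest.finite_flows [Fintype V] {G : Digraph V} (hG : IsForest G) (d : ℕ) :
    (flows G d).Finite := by
  rw [hG.flows_eq_iterSums]
  exact finite_iterSums (finite_unitFlows G) d

/-! ### The generating series of flows -/

/-- Flows that vanish at some vertex of `P`. -/
def blockedFlows [Fintype V] (G : Digraph V) (P : Finset V) (d : ℕ) :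
    Set ((V → ℕ) × (V → ℕ)) :=
  {w ∈ flows G d | ∃ k ∈ P, w.2 k = 0}

/-- The generating series of flows. -/
def flowSeries [Fintype V] (G : Digraph V) : PowerSeries ℤ :=
  PowerSeries.mk fun d => ((flows G d).ncard : ℤ)

/-- The generating series of blocked flows. -/
def blockedSeries [Fintype V] (G : Digraph V) (P : Finset V) : PowerSeries ℤ :=
  PowerSeries.mk fun d => ((blockedFlows G P d).ncard : ℤ)

/-- Removal of the edges with tail `k`. -/
def cut (G : Digraph V) (k : V) : Digraph V where
  Adj u v := G.Adj u v ∧ u ≠ k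

open Classical in
/-- The number of vertices that are not sinks. -/
def tailCard [Fintype V] (G : Digraph V) : ℕ :=
  (Finset.univ.filter fun v => ¬ IsSink G v).card

theorem isSink_cut_iff {G : Digraph V} {k v : V} : IsSink (cut G k) v ↔ IsSink G v ∨ v = k := by
  simp only [IsSink, cut, not_and, not_not]
  constructor
  · intro h
    by_cases hv : v = k
    · exact Or.inr hv
    · exact Or.inl fun w hw => hv (h w hw)
  · rintro (h | h) w hw
    · exact absurd hw (h w)
    · exact h

theorem tailCard_cut [Fintype V] {G : Digraph V} {k : V} (hk : ¬ IsSink G k) :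
    tailCard (cut G k) + 1 = tailCard G := by
  classical
  have : (Finset.univ.filter fun v => ¬ IsSink (cut G k) v) =
      (Finset.univ.filter fun v => ¬ IsSink G v).erase k := by
    ext v
    simp [isSink_cut_iff, and_comm]
  rw [tailCard, tailCard, this, Finset.card_erase_add_one (by simpa using hk)]

theorem IsForest.of_le {G H : Digraph V} (hG : IsForest G) (h : ∀ u v, H.Adj u v → G.Adj u v) :
    IsForest H where
  dag v hv := hG.dag v (TransGen.mono h _ _ hv)
  rightUnique _ _ _ h1 h2 := hG.rightUnique (h _ _ h1) (h _ _ h2)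
  acyclic := hG.acyclic.anti (Digraph.toSimpleGraphInclusive_mono fun u v => h u v)

theorem IsForest.cut {G : Digraph V} (hG : IsForest G) (k : V) : IsForest (cut G k) :=
  hG.of_le fun _ _ h => h.1

/-- Cutting turns `k` into a sink, which forces `y k = 0`; edges carrying no flow do not affect any
inflow. -/
theorem flows_cut [Fintype V] (G : Digraph V) (k : V) (d : ℕ) :
    flows (cut G k) d = {w ∈ flows G d | w.2 k = 0} := by
  ext w
  have key (h : w.2 k = 0) (v : V) : inflow (cut G k) w.2 v = inflow G w.2 v := by
    refine inflow_congr fun u hu => ?_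
    have huk : u ≠ k := by rintro rfl; tauto
    have : G.Adj u v := by rcases hu with hu | hu; exacts [hu.1.1, hu.1]
    exact ⟨⟨this, huk⟩, this, rfl⟩
  constructor
  · intro hw
    have hk : w.2 k = 0 := hw.2.1 k (isSink_cut_iff.2 (Or.inr rfl))
    exact ⟨⟨hw.1, fun v hv => hw.2.1 v (isSink_cut_iff.2 (Or.inl hv)),
      fun v => key hk v ▸ hw.2.2 v⟩, hk⟩
  · rintro ⟨hw, hk⟩
    refine ⟨hw.1, fun v hv => ?_, fun v => (key hk v).symm ▸ hw.2.2 v⟩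
    rcases isSink_cut_iff.1 hv with h | rfl
    · exact hw.2.1 v h
    · exact hk

theorem blockedSeries_empty [Fintype V] (G : Digraph V) : blockedSeries G ∅ = 0 := by
  ext d
  simp [blockedSeries, blockedFlows]

theorem IsForest.blockedSeries_insert [Fintype V] [DecidableEq V] {G : Digraph V}
    (hG : IsForest G) (k : V) (P : Finset V) :
    blockedSeries G (insert k P) =
      blockedSeries G P + flowSeries (BayesNet.cut G k) - blockedSeries (BayesNet.cut G k) P := by
  ext d
  have hU : blockedFlows G (insert k P) d = blockedFlows G P d ∪ flows (BayesNet.cut G k) d := by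
    ext w
    simp only [blockedFlows, flows_cut, Finset.exists_mem_insert, Set.mem_union, Set.mem_ofPred_eq,
      and_or_left, or_comm]
  have hI : blockedFlows (BayesNet.cut G k) P d =
      blockedFlows G P d ∩ flows (BayesNet.cut G k) d := by
    ext w
    simp only [blockedFlows, flows_cut, Set.mem_inter_iff, Set.mem_ofPred_eq]
    tauto
  have := Set.ncard_union_add_ncard_inter (blockedFlows G P d) (flows (BayesNet.cut G k) d)
    ((hG.finite_flows d).subset fun _ h => h.1) ((hG.cut k).finite_flows d)
  rw [← hU, ← hI] at this
  simp only [blockedSeries, flowSeries, map_add, map_sub, PowerSeries.coeff_mk]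
  omega

open Classical in
/-- The tails of the edges on the directed walk from `i` to `t`. -/
def walkTails [Fintype V] (G : Digraph V) (i t : V) : Finset V :=
  Finset.univ.filter fun u => ReflTransGen G.Adj i u ∧ TransGen G.Adj u t

/-- A flow positive along the whole walk can always be reduced by it: nothing enters the source `i`,
so its outflow must be supplied there, and nothing leaves the sink `t`, so what arrives is slack. -/
theorem IsForest.flowSeries_mul_one_sub [Fintype V] {G : Digraph V} (hG : IsForest G) {i t : V}
    (hi : IsSource G i) (ht : IsSink G t) (hit : TransGen G.Adj i t) :
    flowSeries G * (1 - PowerSeries.X) = blockedSeries G (walkTails G i t) := by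
  classical
  have hiP : i ∈ walkTails G i t := by simp [walkTails, hit, ReflTransGen.refl]
  ext d
  rw [mul_sub, mul_one, map_sub]
  cases d with
  | zero =>
    -- In degree 0 the zero flow is blocked because the walk has at least the tail `i`.
    have : blockedFlows G (walkTails G i t) 0 = {0} := by
      rw [blockedFlows, hG.flows_zero]
      ext w
      simp only [Set.mem_ofPred_eq, Set.mem_singleton_iff, and_iff_left_iff_imp]
      rintro rfl
      exact ⟨i, hiP, rfl⟩
    simp [flowSeries, blockedSeries, this, hG.flows_zero]
  | succ d =>
    rw [PowerSeries.coeff_succ_mul_X]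
    have hU : flows G (d + 1) = (· + unitFlow G i t) '' flows G d ∪
        blockedFlows G (walkTails G i t) (d + 1) := by
      ext w
      constructor
      · intro hw
        by_cases hb : ∃ k ∈ walkTails G i t, w.2 k = 0
        · exact Or.inr ⟨hw, hb⟩
        · left
          push Not at hb
          have hpos : ∀ u, ReflTransGen G.Adj i u → TransGen G.Adj u t → 0 < w.2 u :=
            fun u h1 h2 => Nat.pos_of_ne_zero (hb u (by simp [walkTails, h1, h2]))
          obtain ⟨x, hix, hxt⟩ := TransGen.tail'_iff.1 hit
          have hx := hpos x hix (.single hxt)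
          have hxle := le_inflow w.2 hxt
          have hi0 := hw.2.2 i
          rw [inflow_eq_zero fun u hu => absurd hu (hi u)] at hi0
          have := hpos i .refl hit
          refine hG.exists_eq_add_unitFlow hit.to_reflTransGen hw (by omega) hpos ?_
          have := hw.2.1 t ht
          omega
      · rintro (⟨w', hw', rfl⟩ | h)
        · exact add_mem_flows hw' (hG.unitFlow_mem_flows hit.to_reflTransGen)
        · exact h.1
    have hD : Disjoint ((· + unitFlow G i t) '' flows G d)
        (blockedFlows G (walkTails G i t) (d + 1)) := by
      rw [Set.disjoint_left]
      rintro _ ⟨w', -, rfl⟩ ⟨-, k, hk, hk0⟩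
      simp only [walkTails, Finset.mem_filter, Finset.mem_univ, true_and] at hk
      simp [unitFlow, hk] at hk0
    have := Set.ncard_union_eq hD ((hG.finite_flows d).image _)
      ((hG.finite_flows (d + 1)).subset fun _ h => h.1)
    rw [← hU, Set.ncard_image_of_injective _ (add_left_injective _)] at this
    simp only [flowSeries, blockedSeries, PowerSeries.coeff_mk]
    omega

/-- With only sinks, `y = 0` and `α` is arbitrary of sum `d`, so the series is `1 / (1 - X) ^ card
V`. -/
theorem hasPole_flowSeries_of_tailCard_eq_zero [Fintype V] {G : Digraph V}
    (h : tailCard G = 0) : HasPole (flowSeries G) (Fintype.card V) 1 := by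
  classical
  refine ⟨1, ?_, by simp⟩
  have hs : ∀ v, IsSink G v := by
    simpa [tailCard, Finset.card_eq_zero, Finset.filter_eq_empty_iff] using h
  have : flowSeries G = (PowerSeries.mk 1) ^ Fintype.card V := by
    ext d
    rw [← Finset.card_univ, ← Finset.prod_const, PowerSeries.coeff_prod]
    simp only [PowerSeries.coeff_mk, Pi.one_apply, Finset.prod_const_one, Finset.sum_const,
      nsmul_eq_mul, mul_one, flowSeries]
    rw [← Set.ncard_coe_finset]
    congr 1
    refine Set.ncard_congr' ?_
    refine
      { toFun := fun w => ⟨Finsupp.equivFunOnFinite.symm w.1.1, ?_⟩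
        invFun := fun l => ⟨(l.1, 0), ?_⟩
        left_inv := ?_
        right_inv := ?_ }
    · simpa [Finset.mem_finsuppAntidiag] using w.2.1
    · have := l.2
      simp only [Finset.mem_coe, Finset.mem_finsuppAntidiag] at this
      exact ⟨this.1, fun _ _ => rfl, fun _ => Nat.zero_le _⟩
    · intro w
      exact Subtype.ext (Prod.ext rfl (funext fun v => (w.2.2.1 v (hs v)).symm))
    · intro l
      exact Subtype.ext (Finsupp.ext fun _ => rfl)
  rw [this, ← mul_pow, PowerSeries.mk_one_mul_one_sub_eq_one, one_pow, Polynomial.coe_one]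

/-- Inclusion-exclusion, one tail at a time. The overlap consists of blocked flows of a cut graph
and has pole order one less, so it adds 0 to the leading coefficient. For this, `ih` need only bound
the pole orders of double cuts. -/
theorem IsForest.hasPole_blockedSeries [Fintype V] {G : Digraph V} (hG : IsForest G)
    (ih : ∀ H : Digraph V, IsForest H → tailCard H < tailCard G →
      ∃ e, HasPole (flowSeries H) (Fintype.card V + tailCard H) e)
    (P : Finset V) (hP : ∀ k ∈ P, ¬ IsSink G k) {D : ℕ} (hD : D + 1 = Fintype.card V + tailCard G)
    (e : V → ℤ) (he : ∀ k ∈ P, HasPole (flowSeries (BayesNet.cut G k)) D (e k)) :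
    HasPole (blockedSeries G P) D (∑ k ∈ P, e k) := by
  classical
  induction P using Finset.induction_on generalizing G D e with
  | empty => simpa [blockedSeries_empty] using HasPole.zero D
  | insert k P hk ihP =>
    have hlt := tailCard_cut (hP k (Finset.mem_insert_self _ _))
    have hV : 0 < Fintype.card V := Fintype.card_pos_iff.2 ⟨k⟩
    -- There is at least one vertex and one non-sink, so the pole order can be lowered once more for
    -- the overlap.
    obtain ⟨D, rfl⟩ := Nat.exists_eq_add_of_le' (show 1 ≤ D by omega)
    have hP' : ∀ p ∈ P, ¬ IsSink (BayesNet.cut G k) p := fun p hp h => by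
      rcases isSink_cut_iff.1 h with h | rfl
      · exact hP p (Finset.mem_insert_of_mem hp) h
      · exact hk hp
    have hex : ∀ p ∈ P, ∃ e, HasPole (flowSeries (BayesNet.cut (BayesNet.cut G k) p)) D e := by
      intro p hp
      have hlt' := tailCard_cut (hP' p hp)
      obtain ⟨e, he⟩ := ih _ ((hG.cut k).cut p) (by omega)
      exact ⟨e, by convert he using 1; omega⟩
    choose! e' he' using hex
    have h1 := ihP hG ih (fun p hp => hP p (Finset.mem_insert_of_mem hp)) hD e
      fun p hp => he p (Finset.mem_insert_of_mem hp)
    have h2 := ihP (hG.cut k) (fun H hH hlt' => ih H hH (by omega)) hP' (D := D) (by omega) e' he'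
    have h3 := he k (Finset.mem_insert_self _ _)
    rw [hG.blockedSeries_insert, Finset.sum_insert hk]
    convert (h1.add h3).sub h2.succ using 1
    ring

theorem not_isSink_of_mem_walkTails [Fintype V] {G : Digraph V} {i t k : V}
    (hk : k ∈ walkTails G i t) : ¬ IsSink G k := by
  classical
  simp only [walkTails, Finset.mem_filter] at hk
  exact fun h => h.not_transGen hk.2.2

/-- Strong induction on the number of non-sinks. Leading coefficients are sums of positive ones over
a nonempty walk, so they never cancel. -/
theorem IsForest.exists_hasPole_flowSeries [Fintype V] {G : Digraph V} (hG : IsForest G) :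
    ∃ e, 0 < e ∧ HasPole (flowSeries G) (Fintype.card V + tailCard G) e := by
  classical
  induction hm : tailCard G using Nat.strong_induction_on generalizing G with
  | _ m ih =>
    subst hm
    rcases Nat.eq_zero_or_pos (tailCard G) with h0 | hpos
    · exact ⟨1, one_pos, by simpa [h0] using hasPole_flowSeries_of_tailCard_eq_zero h0⟩
    · obtain ⟨v, hv⟩ := Finset.card_pos.1 hpos
      simp only [Finset.mem_filter, Finset.mem_univ, true_and] at hv
      obtain ⟨i, hi, hiv⟩ := hG.exists_source v
      obtain ⟨t, ht, hvt⟩ := hG.exists_sink v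
      have hvt' : TransGen G.Adj v t := by
        rcases reflTransGen_iff_eq_or_transGen.1 hvt with rfl | h
        exacts [absurd ht hv, h]
      have hit : TransGen G.Adj i t := TransGen.trans_right hiv hvt'
      have hex : ∀ k ∈ walkTails G i t, ∃ e, 0 < e ∧
          HasPole (flowSeries (BayesNet.cut G k)) (Fintype.card V + tailCard G - 1) e := by
        intro k hk
        have hlt := tailCard_cut (not_isSink_of_mem_walkTails hk)
        obtain ⟨e, he, he'⟩ := ih _ (by omega) (hG.cut k) rfl
        exact ⟨e, he, by convert he' using 1; omega⟩
      choose! e he he' using hex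
      have hB := hG.hasPole_blockedSeries
        (fun H hH hlt => (ih _ hlt hH rfl).imp fun _ h => h.2) (walkTails G i t)
        (fun k hk => not_isSink_of_mem_walkTails hk) (by omega) e he'
      rw [← hG.flowSeries_mul_one_sub hi ht hit] at hB
      refine ⟨_, Finset.sum_pos he ⟨i, by simp [walkTails, hit, ReflTransGen.refl]⟩, ?_⟩
      convert hB.of_mul using 1
      omega

theorem IsForest.hasPole_flowSeries [Fintype V] {G : Digraph V} (hG : IsForest G) {i t : V}
    (hi : IsSource G i) (ht : IsSink G t) (hit : TransGen G.Adj i t) (e : V → ℤ)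
    (he : ∀ k ∈ walkTails G i t,
      HasPole (flowSeries (BayesNet.cut G k))
        (Fintype.card V + tailCard (BayesNet.cut G k)) (e k)) :
    HasPole (flowSeries G) (Fintype.card V + tailCard G) (∑ k ∈ walkTails G i t, e k) := by
  have hi' : i ∈ walkTails G i t := by
    classical
    simp [walkTails, hit, ReflTransGen.refl]
  have hV := tailCard_cut (not_isSink_of_mem_walkTails hi')
  have hB := hG.hasPole_blockedSeries
    (fun H hH _ => hH.exists_hasPole_flowSeries.imp fun _ h => h.2) (walkTails G i t)
    (fun k hk => not_isSink_of_mem_walkTails hk)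
    (D := Fintype.card V + tailCard (BayesNet.cut G i)) (by omega) e fun k hk => by
      have := tailCard_cut (not_isSink_of_mem_walkTails hk)
      convert he k hk using 2
      omega
  rw [← hG.flowSeries_mul_one_sub hi ht hit] at hB
  convert hB.of_mul using 1
  omega

end BayesNet

end

noncomputable section

/-! ### Treks in directed forests -/

namespace BayesNet

open Relation

variable {V : Type*}

theorem skeleton_adj {G : Digraph V} {u v : V} :
    (skeleton G).Adj u v ↔ u ≠ v ∧ (G.Adj u v ∨ G.Adj v u) :=
  SimpleGraph.fromRel_adj _ _ _

theorem IsDAG.ne_of_adj {G : Digraph V} (hG : IsDAG G) {u v : V} (h : G.Adj u v) : u ≠ v := by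
  rintro rfl
  exact hG u (.single h)

/-- The walk `p` runs along the directed walk from `i` to `j`, in either direction. -/
structure Traces (G : Digraph V) (i j : V) {a b : V} (p : (skeleton G).Walk a b) : Prop where
  isPath : p.IsPath
  mem_support : ∀ v, v ∈ p.support ↔ ReflTransGen G.Adj i v ∧ ReflTransGen G.Adj v j
  uses : ∀ k l, Uses G p k l ↔ ReflTransGen G.Adj i k ∧ G.Adj k l ∧ ReflTransGen G.Adj l j

theorem Traces.reverse {G : Digraph V} {i j a b : V} {p : (skeleton G).Walk a b}
    (h : Traces G i j p) : Traces G i j p.reverse where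
  isPath := h.isPath.reverse
  mem_support v := by simpa using h.mem_support v
  uses k l := by simpa [Uses] using h.uses k l

/-- Prepend edges: since the edge leaving `i` is unique, every vertex reached from `i` is `i` or is
reached from its successor. -/
theorem IsForest.exists_traces {G : Digraph V} (hG : IsForest G) {i j : V}
    (hij : ReflTransGen G.Adj i j) : ∃ p : (skeleton G).Walk i j, Traces G i j p := by
  induction hij using ReflTransGen.head_induction_on with
  | refl =>
    refine ⟨.nil, .nil, fun v => ?_, fun k l => ?_⟩
    · simp only [SimpleGraph.Walk.support_nil, List.mem_singleton]
      refine ⟨by rintro rfl; exact ⟨.refl, .refl⟩, fun ⟨h1, h2⟩ => ?_⟩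
      rcases reflTransGen_iff_eq_or_transGen.1 h1 with h | h
      · exact h
      · exact absurd (h.trans_left h2) (hG.dag _)
    · refine ⟨by simp [Uses], fun ⟨h1, h2, h3⟩ => ?_⟩
      exact absurd (h3.trans h1) (hG.not_reaches_of_adj h2)
  | @head i x hix hxj ih =>
    obtain ⟨p, hp⟩ := ih
    have hsplit {v : V} : ReflTransGen G.Adj i v ↔ v = i ∨ ReflTransGen G.Adj x v := by
      refine ⟨fun h => ?_, ?_⟩
      · rcases reflTransGen_iff_eq_or_transGen.1 h with h | h
        exacts [Or.inl h, Or.inr (hG.reaches_of_transGen hix h)]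
      · rintro (rfl | h)
        exacts [.refl, h.head hix]
    refine ⟨.cons (skeleton_adj.2 ⟨hG.dag.ne_of_adj hix, Or.inl hix⟩) p, ?_, fun v => ?_,
      fun k l => ?_⟩
    · rw [SimpleGraph.Walk.cons_isPath_iff, hp.mem_support]
      exact ⟨hp.isPath, fun h => hG.not_reaches_of_adj hix h.1⟩
    · rw [SimpleGraph.Walk.support_cons, List.mem_cons, hp.mem_support, hsplit]
      constructor
      · rintro (rfl | h)
        exacts [⟨Or.inl rfl, hxj.head hix⟩, ⟨Or.inr h.1, h.2⟩]
      · rintro ⟨rfl | h, h'⟩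
        exacts [Or.inl rfl, Or.inr ⟨h, h'⟩]
    · have hu := hp.uses k l
      simp only [Uses, SimpleGraph.Walk.edges_cons, List.mem_cons, Sym2.eq_iff] at hu ⊢
      rw [hsplit]
      constructor
      · rintro ⟨hkl, (⟨rfl, rfl⟩ | ⟨rfl, rfl⟩) | h⟩
        · exact ⟨Or.inl rfl, hkl, hxj⟩
        · exact absurd (ReflTransGen.single hkl) (hG.not_reaches_of_adj hix)
        · have := hu.1 ⟨hkl, h⟩
          exact ⟨Or.inr this.1, this.2⟩
      · rintro ⟨rfl | h, hkl, hlj⟩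
        · exact ⟨hkl, Or.inl (Or.inl ⟨rfl, hG.rightUnique hkl hix⟩)⟩
        · exact ⟨hkl, Or.inr (hu.2 ⟨h, hkl, hlj⟩).2⟩

/-- The edges on the directed walk from `i` to `j`. -/
def walkEdges [Finite V] (G : Digraph V) (i j : V) : Finset (Edge G) :=
  (Set.toFinite {e : Edge G |
    ReflTransGen G.Adj i e.1.1 ∧ ReflTransGen G.Adj e.1.2 j}).toFinset

theorem mem_walkEdges [Finite V] {G : Digraph V} {i j : V} {e : Edge G} :
    e ∈ walkEdges G i j ↔ ReflTransGen G.Adj i e.1.1 ∧ ReflTransGen G.Adj e.1.2 j := by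
  simp [walkEdges]

theorem IsForest.exists_trek_of_traces [Finite V] {G : Digraph V} (hG : IsForest G) {i j a b : V}
    (hij : ReflTransGen G.Adj i j) {p : (skeleton G).Walk a b} (hp : Traces G i j p) :
    ∃ P : Trek G a b, P.edges = walkEdges G i j ∧ P.top = i := by
  refine ⟨⟨⟨p, hp.isPath⟩, fun k k' l h h' => ?_⟩, ?_, ?_⟩
  · rw [hp.uses] at h h'
    exact hG.eq_of_reaches_of_adj h.1 h'.1 h.2.1 h'.2.1
  · ext e
    rw [mem_walkEdges]
    simp only [Trek.edges, Set.Finite.mem_toFinset, Set.mem_ofPred_eq, hp.uses]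
    exact ⟨fun h => ⟨h.1, h.2.2⟩, fun h => ⟨h.1, e.2, h.2⟩⟩
  · have hex : ∃ v, v ∈ p.support ∧ ∀ u, ¬ Uses G p u v := by
      refine ⟨i, (hp.mem_support i).2 ⟨.refl, hij⟩, fun u hu => ?_⟩
      rw [hp.uses] at hu
      exact hG.not_reaches_of_adj hu.2.1 hu.1
    have hspec := Classical.epsilon_spec_aux ⟨a⟩ _ hex
    obtain ⟨h1, h2⟩ := hspec
    rw [hp.mem_support] at h1
    obtain h | ⟨u, hu, hu'⟩ := (ReflTransGen.cases_tail_iff _ _ _).1 h1.1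
    · exact h
    · exact absurd ((hp.uses _ _).2 ⟨hu, hu', h1.2⟩) (h2 u)

theorem IsForest.subsingleton_trek {G : Digraph V} (hG : IsForest G) (i j : V) :
    Subsingleton (Trek G i j) :=
  ⟨fun _ _ => Subtype.ext ((hG.acyclic.subsingleton_path _ _).elim _ _)⟩

/-- A turn at a vertex with two incoming edges is a collider; a turn at one with two outgoing edges
contradicts uniqueness of the outgoing edge. -/
theorem IsForest.reaches_or_reaches_of_walk {G : Digraph V} (hG : IsForest G) {i j : V}
    (p : (skeleton G).Walk i j) (hp : p.IsPath)
    (hc : ∀ k k' l, Uses G p k l → Uses G p k' l → k = k') :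
    ReflTransGen G.Adj i j ∨ ReflTransGen G.Adj j i := by
  induction p with
  | nil => exact Or.inl .refl
  | @cons i x j hix p ih =>
    rw [SimpleGraph.Walk.cons_isPath_iff] at hp
    have huse {k l : V} (h : Uses G p k l) : Uses G (.cons hix p) k l :=
      ⟨h.1, by simpa using Or.inr h.2⟩
    have := ih hp.1 fun k k' l h h' => hc k k' l (huse h) (huse h')
    rcases (skeleton_adj.1 hix).2 with h | h
    · rcases this with h' | h'
      · exact Or.inl (h'.head h)
      · obtain rfl | ⟨u, hju, hux⟩ := (ReflTransGen.cases_tail_iff _ _ _).1 h'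
        · exact Or.inl (.single h)
        · obtain ⟨q, hq⟩ := hG.exists_traces h'
          -- Paths in an acyclic graph are unique, so `p` is the reversed directed walk and ends the
          -- collider argument with its edge `u → x`.
          have hpq : p = q.reverse :=
            congrArg Subtype.val ((hG.acyclic.subsingleton_path _ _).elim
              ⟨p, hp.1⟩ ⟨_, hq.isPath.reverse⟩)
          have hpu : Uses G p u x := by
            rw [hpq]
            exact (hq.reverse.uses u x).2 ⟨hju, hux, .refl⟩
          have : i = u := hc i u x ⟨h, by simp⟩ (huse hpu)
          subst this
          exact absurd (p.fst_mem_support_of_mem_edges hpu.2) hp.2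
    · rcases this with h' | h'
      · rcases ReflTransGen.cases_head h' with rfl | ⟨y, hy, hyj⟩
        · exact Or.inr (.single h)
        · rw [hG.rightUnique hy h] at hyj
          exact Or.inl hyj
      · exact Or.inr (h'.tail h)

/-! ### The Hilbert function of the ideal of a directed forest -/

/-- The exponent vector of the monomial of the trek along the directed walk from `i` to `j`. -/
def trekExponent [Finite V] (G : Digraph V) (i j : V) : V ⊕ Edge G →₀ ℕ :=
  Finsupp.single (Sum.inl i) 1 + ∑ e ∈ walkEdges G i j, Finsupp.single (Sum.inr e) 1

theorem IsForest.finsum_trek_eq_monomial [Finite V] {G : Digraph V} (hG : IsForest G) {i j a b : V}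
    (P : Trek G a b) (hP : P.edges = walkEdges G i j ∧ P.top = i) :
    (∑ᶠ P : Trek G a b, MvPolynomial.X (Sum.inl P.top) * ∏ e ∈ P.edges, MvPolynomial.X (Sum.inr e) :
      MvPolynomial (V ⊕ Edge G) ℂ) = MvPolynomial.monomial (trekExponent G i j) 1 := by
  have := hG.subsingleton_trek a b
  have : Unique (Trek G a b) := uniqueOfSubsingleton P
  rw [finsum_unique, Subsingleton.elim default P, hP.1, hP.2, trekExponent]
  rw [← one_mul (1 : ℂ), ← MvPolynomial.monomial_mul, MvPolynomial.monomial_sum_one]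
  rfl

/-- The order on `V` only decides in which direction a directed walk is read; the trek has the same
monomial either way. -/
theorem IsForest.span_range_trek [Finite V] [LinearOrder V] {G : Digraph V} (hG : IsForest G) :
    Submodule.span ℂ (Set.range fun p : SigmaIndex V =>
      (∑ᶠ P : Trek G p.1.1 p.1.2,
        MvPolynomial.X (Sum.inl P.top) * ∏ e ∈ P.edges, MvPolynomial.X (Sum.inr e) :
      MvPolynomial (V ⊕ Edge G) ℂ)) =
    Submodule.span ℂ ((fun u => MvPolynomial.monomial u (1 : ℂ)) ''
      {u | ∃ i j, ReflTransGen G.Adj i j ∧ trekExponent G i j = u}) := by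
  apply le_antisymm <;> rw [Submodule.span_le]
  · rintro _ ⟨⟨⟨a, b⟩, hab⟩, rfl⟩
    rcases isEmpty_or_nonempty (Trek G a b) with h | ⟨⟨P⟩⟩
    · simp only [finsum_of_isEmpty]
      exact Submodule.zero_mem _
    · rcases hG.reaches_or_reaches_of_walk P.1.1 P.1.2 P.2 with h | h
      · obtain ⟨p, hp⟩ := hG.exists_traces h
        obtain ⟨P, hP⟩ := hG.exists_trek_of_traces h hp
        simp only [hG.finsum_trek_eq_monomial P hP]
        exact Submodule.subset_span ⟨_, ⟨a, b, h, rfl⟩, rfl⟩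
      · obtain ⟨p, hp⟩ := hG.exists_traces h
        obtain ⟨P, hP⟩ := hG.exists_trek_of_traces h hp.reverse
        simp only [hG.finsum_trek_eq_monomial P hP]
        exact Submodule.subset_span ⟨_, ⟨b, a, h, rfl⟩, rfl⟩
  · rintro _ ⟨_, ⟨i, j, h, rfl⟩, rfl⟩
    apply Submodule.subset_span
    obtain ⟨p, hp⟩ := hG.exists_traces h
    rcases le_total i j with hij | hij
    · obtain ⟨P, hP⟩ := hG.exists_trek_of_traces h hp
      exact ⟨⟨(i, j), hij⟩, hG.finsum_trek_eq_monomial P hP⟩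
    · obtain ⟨P, hP⟩ := hG.exists_trek_of_traces h hp.reverse
      exact ⟨⟨(j, i), hij⟩, hG.finsum_trek_eq_monomial P hP⟩

open Classical in
/-- The sources and the outgoing flow encoded by an exponent vector. -/
def exponentFlow [Fintype V] (G : Digraph V) :
    (V ⊕ Edge G →₀ ℕ) →+ (V → ℕ) × (V → ℕ) where
  toFun w := (fun v => w (Sum.inl v), fun v => ∑ e : Edge G, if e.1.1 = v then w (Sum.inr e) else 0)
  map_zero' := by ext <;> simp
  map_add' w w' := by
    ext v
    · simp
    · simp only [Finsupp.add_apply, Prod.snd_add, Pi.add_apply, ← Finset.sum_add_distrib]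
      refine Finset.sum_congr rfl fun e _ => ?_
      split_ifs <;> simp

/-- An edge is the only one leaving its tail, so edges may be indexed by their tails without loss.
-/
theorem IsForest.exponentFlow_snd [Fintype V] {G : Digraph V} (hG : IsForest G)
    (w : V ⊕ Edge G →₀ ℕ) (e : Edge G) : (exponentFlow G w).2 e.1.1 = w (Sum.inr e) := by
  classical
  refine (Finset.sum_eq_single e (fun e' _ he' => if_neg fun h => he' ?_) (by simp)).trans
    (if_pos rfl)
  have he := e'.2
  rw [h] at he
  exact Subtype.ext (Prod.ext h (hG.rightUnique he e.2))

theorem IsForest.exponentFlow_injective [Fintype V] {G : Digraph V} (hG : IsForest G) :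
    Function.Injective (exponentFlow G) := by
  intro w w' h
  ext (v | e)
  · exact congrFun (congrArg Prod.fst h) v
  · rw [← hG.exponentFlow_snd, ← hG.exponentFlow_snd, h]

theorem IsForest.exponentFlow_trekExponent [Fintype V] {G : Digraph V} (hG : IsForest G)
    (i j : V) : exponentFlow G (trekExponent G i j) = unitFlow G i j := by
  classical
  have hr (e : Edge G) : trekExponent G i j (Sum.inr e) = if e ∈ walkEdges G i j then 1 else 0 := by
    simp [trekExponent, Finsupp.single_apply]
  ext v
  · simp [exponentFlow, trekExponent, unitFlow, Finsupp.single_apply,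
      Pi.single_apply, eq_comm]
  · by_cases hv : IsSink G v
    · have h1 : (unitFlow G i j).2 v = 0 := if_neg fun h => hv.not_transGen h.2
      rw [h1]
      refine Finset.sum_eq_zero fun e _ => if_neg ?_
      rintro rfl
      exact hv _ e.2
    · simp only [IsSink, not_forall, not_not] at hv
      obtain ⟨x, hx⟩ := hv
      have := hG.exponentFlow_snd (trekExponent G i j) ⟨(v, x), hx⟩
      simp only at this
      rw [this, hr, unitFlow]
      refine if_congr ?_ rfl rfl
      rw [mem_walkEdges]
      exact and_congr_right fun _ => ⟨TransGen.head' hx, hG.reaches_of_transGen hx⟩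

theorem IsForest.hilbertSeries_bayesIdeal [Fintype V] [LinearOrder V] {G : Digraph V}
    (hG : IsForest G) : HilbertDegree.hilbertSeries (bayesIdeal G) = flowSeries G := by
  ext d
  simp only [HilbertDegree.hilbertSeries, flowSeries, PowerSeries.coeff_mk, Nat.cast_inj]
  rw [bayesIdeal, trekHom, HilbertDegree.hilbertFunction_ker_aeval _ _ hG.span_range_trek,
    ← Set.ncard_image_of_injective _ hG.exponentFlow_injective, image_iterSums,
    hG.flows_eq_iterSums]
  congr 2
  ext w
  simp only [Set.mem_image, unitFlows, Set.mem_ofPred_eq]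
  constructor
  · rintro ⟨_, ⟨i, j, h, rfl⟩, rfl⟩
    exact ⟨i, j, h, (hG.exponentFlow_trekExponent i j).symm⟩
  · rintro ⟨i, j, h, rfl⟩
    exact ⟨_, ⟨i, j, h, rfl⟩, hG.exponentFlow_trekExponent i j⟩

end BayesNet

end

noncomputable section

/-! ### Disjoint unions of directed graphs -/

namespace BayesNet

open Relation

variable {V : Type*}

/-- The restriction of a directed graph to the vertices satisfying `p`. -/
def restrict (G : Digraph V) (p : V → Prop) : Digraph {v // p v} where
  Adj u v := G.Adj u.1 v.1

theorem IsForest.restrict {G : Digraph V} (hG : IsForest G) (p : V → Prop) :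
    IsForest (restrict G p) where
  dag v hv := hG.dag v.1 (TransGen.lift Subtype.val (fun _ _ h => h) _ _ hv)
  rightUnique _ _ _ h h' := Subtype.ext (hG.rightUnique h h')
  acyclic := hG.acyclic.comap
    ⟨Subtype.val, fun {u v} h => by
      rw [skeleton_adj] at h ⊢
      exact ⟨fun huv => h.1 (Subtype.ext huv), h.2⟩⟩ Subtype.val_injective

/-- The restriction of a pair of functions to the vertices satisfying `p`. -/
def restrictPair (p : V → Prop) (w : (V → ℕ) × (V → ℕ)) :
    ({v // p v} → ℕ) × ({v // p v} → ℕ) :=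
  (fun v => w.1 v, fun v => w.2 v)

theorem inflow_restrict [Fintype V] {G : Digraph V} {p : V → Prop} [Fintype {v // p v}]
    (hp : ∀ u v, G.Adj u v → (p u ↔ p v)) (y : V → ℕ) (v : {v // p v}) :
    inflow (restrict G p) (fun u => y u) v = inflow G y v := by
  classical
  rw [inflow, inflow, ← Finset.sum_subset (Finset.subset_univ (Finset.univ.filter p))]
  · exact (Finset.sum_subtype _ (by simp) fun u => if G.Adj u v then y u else 0).symm
  · intro u _ hu
    refine if_neg fun h => hu ?_
    simpa using (hp u v h).2 v.2

theorem isSink_restrict_iff {G : Digraph V} {p : V → Prop}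
    (hp : ∀ u v, G.Adj u v → (p u ↔ p v)) (v : {v // p v}) :
    IsSink (restrict G p) v ↔ IsSink G v :=
  ⟨fun h w hw => h ⟨w, (hp _ _ hw).1 v.2⟩ hw, fun h w hw => h w hw⟩

/-- No edge joins the two parts, so the constraints decouple. A separate `q` lets both parts be
given as connected components. -/
theorem mem_flows_iff_restrict [Fintype V] {G : Digraph V} {p q : V → Prop} [Fintype {v // p v}]
    [Fintype {v // q v}] (hpq : ∀ v, q v ↔ ¬ p v) (hp : ∀ u v, G.Adj u v → (p u ↔ p v))
    (d : ℕ) (w : (V → ℕ) × (V → ℕ)) :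
    w ∈ flows G d ↔ ∃ x ∈ Finset.HasAntidiagonal.antidiagonal d,
      restrictPair p w ∈ flows (restrict G p) x.1 ∧
      restrictPair q w ∈ flows (restrict G q) x.2 := by
  classical
  have hq : ∀ u v, G.Adj u v → (q u ↔ q v) := fun u v h => by rw [hpq, hpq, hp u v h]
  have hsum : ∑ v : {v // p v}, w.1 v + ∑ v : {v // q v}, w.1 v = ∑ v, w.1 v := by
    rw [← Finset.sum_filter_add_sum_filter_not Finset.univ p w.1,
      Finset.sum_subtype (p := p) (Finset.univ.filter p) (by simp) w.1,
      Finset.sum_subtype (p := q) (Finset.univ.filter fun v => ¬ p v) (by simp [hpq]) w.1]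
  constructor
  · rintro ⟨h1, h2, h3⟩
    refine ⟨(_, _), Finset.HasAntidiagonal.mem_antidiagonal.2 (hsum.trans h1),
      ⟨rfl, fun v hv => ?_, fun v => ?_⟩,
      ⟨rfl, fun v hv => ?_, fun v => ?_⟩⟩
    · exact h2 v ((isSink_restrict_iff hp v).1 hv)
    · exact (h3 v).trans_eq (congrArg _ (inflow_restrict hp w.2 v).symm)
    · exact h2 v ((isSink_restrict_iff hq v).1 hv)
    · exact (h3 v).trans_eq (congrArg _ (inflow_restrict hq w.2 v).symm)
  · rintro ⟨⟨a, b⟩, hab, ⟨rfl, h2, h3⟩, ⟨rfl, h2', h3'⟩⟩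
    refine ⟨hsum.symm.trans (Finset.HasAntidiagonal.mem_antidiagonal.1 hab),
      fun v hv => ?_, fun v => ?_⟩
    · by_cases h : p v
      · exact h2 ⟨v, h⟩ ((isSink_restrict_iff hp ⟨v, h⟩).2 hv)
      · exact h2' ⟨v, (hpq v).2 h⟩ ((isSink_restrict_iff hq ⟨v, (hpq v).2 h⟩).2 hv)
    · by_cases h : p v
      · exact (h3 ⟨v, h⟩).trans_eq (congrArg _ (inflow_restrict hp w.2 ⟨v, h⟩))
      · exact (h3' ⟨v, (hpq v).2 h⟩).trans_eq
          (congrArg _ (inflow_restrict hq w.2 ⟨v, (hpq v).2 h⟩))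

theorem restrictPair_bijective {p q : V → Prop} (hpq : ∀ v, q v ↔ ¬ p v) :
    Function.Bijective fun w : (V → ℕ) × (V → ℕ) => (restrictPair p w, restrictPair q w) := by
  classical
  constructor
  · intro w w' h
    have h1 := congrArg Prod.fst h
    have h2 := congrArg Prod.snd h
    ext v
    · by_cases hv : p v
      · exact congrFun (congrArg Prod.fst h1) ⟨v, hv⟩
      · exact congrFun (congrArg Prod.fst h2) ⟨v, (hpq v).2 hv⟩
    · by_cases hv : p v
      · exact congrFun (congrArg Prod.snd h1) ⟨v, hv⟩
      · exact congrFun (congrArg Prod.snd h2) ⟨v, (hpq v).2 hv⟩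
  · rintro ⟨x, y⟩
    refine ⟨(fun v => if h : p v then x.1 ⟨v, h⟩ else y.1 ⟨v, (hpq v).2 h⟩,
      fun v => if h : p v then x.2 ⟨v, h⟩ else y.2 ⟨v, (hpq v).2 h⟩), ?_⟩
    ext v
    · simp [restrictPair, v.2]
    · simp [restrictPair, v.2]
    · simp [restrictPair, (hpq _).1 v.2]
    · simp [restrictPair, (hpq _).1 v.2]

theorem IsForest.flowSeries_eq_mul [Fintype V] {G : Digraph V} (hG : IsForest G) {p q : V → Prop}
    [Fintype {v // p v}] [Fintype {v // q v}] (hpq : ∀ v, q v ↔ ¬ p v)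
    (hp : ∀ u v, G.Adj u v → (p u ↔ p v)) :
    flowSeries G = flowSeries (BayesNet.restrict G p) * flowSeries (BayesNet.restrict G q) := by
  ext d
  let E := Equiv.ofBijective _ (restrictPair_bijective hpq)
  have hU : flows G d = ⋃ x ∈ (Finset.HasAntidiagonal.antidiagonal d : Set (ℕ × ℕ)),
      E.symm '' (flows (BayesNet.restrict G p) x.1 ×ˢ flows (BayesNet.restrict G q) x.2) := by
    ext w
    simp only [Equiv.image_symm_eq_preimage, Set.mem_iUnion, Finset.mem_coe, exists_prop]
    exact mem_flows_iff_restrict hpq hp d w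
  rw [PowerSeries.coeff_mul]
  simp only [flowSeries, PowerSeries.coeff_mk]
  rw [hU, (Finset.finite_toSet _).ncard_biUnion, finsum_mem_coe_finset]
  · push_cast
    refine Finset.sum_congr rfl fun x _ => ?_
    rw [Set.ncard_image_of_injective _ E.symm.injective, Set.ncard_prod]
    push_cast
    rfl
  · intro x _
    exact (((hG.restrict p).finite_flows _).prod ((hG.restrict q).finite_flows _)).image _
  · intro x _ y _ hxy
    rw [Function.onFun, Set.disjoint_image_iff E.symm.injective, Set.disjoint_left]
    rintro ⟨a, b⟩ ⟨ha, hb⟩ ⟨ha', hb'⟩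
    exact hxy (Prod.ext (ha.1.symm.trans ha'.1) (hb.1.symm.trans hb'.1))

/-! ### Degrees -/

theorem IsForest.degree_spec [Fintype V] [LinearOrder V] {G : Digraph V} (hG : IsForest G) :
    0 < HilbertDegree.degree (bayesIdeal G) ∧
      HasPole (flowSeries G) (Fintype.card V + tailCard G)
        (HilbertDegree.degree (bayesIdeal G)) := by
  obtain ⟨e, he, hp⟩ := hG.exists_hasPole_flowSeries
  have : HilbertDegree.degree (bayesIdeal G) = e :=
    HilbertDegree.HasDegree.degree_eq
      (HasPole.hasDegree (hG.hilbertSeries_bayesIdeal.symm ▸ hp) he.ne')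
  rw [this]
  exact ⟨he, hp⟩

theorem IsForest.degree_eq_of_hasPole [Fintype V] [LinearOrder V] {G : Digraph V}
    (hG : IsForest G) {D : ℕ} {e : ℤ} (he : e ≠ 0) (h : HasPole (flowSeries G) D e) :
    HilbertDegree.degree (bayesIdeal G) = e :=
  (HasPole.hasDegree (hG.hilbertSeries_bayesIdeal.symm ▸ h) he).degree_eq

theorem IsForest.hasDegree [Fintype V] [LinearOrder V] {G : Digraph V} (hG : IsForest G) :
    HilbertDegree.HasDegree (bayesIdeal G) (HilbertDegree.degree (bayesIdeal G)) :=
  HasPole.hasDegree (hG.hilbertSeries_bayesIdeal.symm ▸ hG.degree_spec.2) hG.degree_spec.1.ne'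

/-! ### Downward directed trees -/

theorem exists_directed_walk {G : Digraph V} {u v : V} (h : ReflTransGen G.Adj u v) :
    ∃ p : (skeleton G).Walk u v, ∀ x ∈ p.support, ReflTransGen G.Adj u x := by
  induction h using ReflTransGen.head_induction_on with
  | refl => exact ⟨.nil, by simp [ReflTransGen.refl]⟩
  | @head u x hux hxv ih =>
    obtain ⟨p, hp⟩ := ih
    by_cases h : u = x
    · subst h
      exact ⟨p, hp⟩
    · refine ⟨.cons (skeleton_adj.2 ⟨h, Or.inl hux⟩) p, fun y hy => ?_⟩
      rcases List.mem_cons.1 hy with rfl | hy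
      · exact .refl
      · exact (hp y hy).head hux

theorem reachable_of_reaches {G : Digraph V} {u v : V} (h : ReflTransGen G.Adj u v) :
    (skeleton G).Reachable u v :=
  (exists_directed_walk h).elim fun p _ => p.reachable

/-- Two edges leaving `v` would both extend to simple paths from `v` to `s`, and a tree has only
one. -/
theorem IsDownwardTree.isForest {G : Digraph V} {s : V} (hG : IsDownwardTree G s) :
    IsForest G where
  dag := hG.isDirTree.1
  acyclic := hG.isDirTree.2.isAcyclic
  rightUnique v w w' h h' := by
    have hex : ∀ x, G.Adj v x → ∃ p : (skeleton G).Path v s, p.1.snd = x := by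
      intro x hx
      obtain ⟨p, hp⟩ := exists_directed_walk (hG.toSink v x hx)
      classical
      refine ⟨⟨.cons (skeleton_adj.2 ⟨hG.isDirTree.1.ne_of_adj hx, Or.inl hx⟩) p.bypass, ?_⟩,
        by simp⟩
      rw [SimpleGraph.Walk.cons_isPath_iff]
      exact ⟨p.bypass_isPath, fun hv => hG.isDirTree.1 v
        (.head' hx (hp v (p.support_bypass_subset_support hv)))⟩
    obtain ⟨p, rfl⟩ := hex w h
    obtain ⟨p', rfl⟩ := hex w' h'
    rw [(hG.isDirTree.2.isAcyclic.subsingleton_path _ _).elim p p']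

/-- Reaching `t` survives each undirected step: a step along an arrow uses the only edge leaving
that vertex, hence the one towards `t`. -/
theorem IsForest.reaches_of_reachable {G : Digraph V} (hG : IsForest G) {t w : V}
    (ht : IsSink G t) (h : (skeleton G).Reachable t w) : ReflTransGen G.Adj w t := by
  rw [SimpleGraph.reachable_iff_reflTransGen] at h
  induction h with
  | refl => exact .refl
  | tail _ hadj ih =>
    rcases (skeleton_adj.1 hadj).2 with h | h
    · rcases reflTransGen_iff_eq_or_transGen.1 ih with rfl | ht'
      · exact absurd h (ht _)
      · exact hG.reaches_of_transGen h ht'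
    · exact ih.head h

theorem IsForest.reachable_iff_reaches {G : Digraph V} (hG : IsForest G) {v t w : V}
    (ht : IsSink G t) (hvt : ReflTransGen G.Adj v t) :
    (skeleton G).Reachable v w ↔ ReflTransGen G.Adj w t :=
  ⟨fun h => hG.reaches_of_reachable ht ((reachable_of_reaches hvt).symm.trans h),
    fun h => (reachable_of_reaches hvt).trans (reachable_of_reaches h).symm⟩

theorem IsForest.isDownwardTree_component {G : Digraph V} (hG : IsForest G) {v t : V}
    (ht : IsSink G t) (hvt : ReflTransGen G.Adj v t) (h : (skeleton G).Reachable v t) :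
    IsDownwardTree (component G v) ⟨t, h⟩ := by
  have hF : IsForest (component G v) := hG.restrict _
  have hlift (w : {w // (skeleton G).Reachable v w}) :
      ReflTransGen (component G v).Adj w ⟨t, h⟩ := by
    obtain ⟨w, hwr⟩ := w
    have hw := (hG.reachable_iff_reaches ht hvt).1 hwr
    induction hw using ReflTransGen.head_induction_on with
    | refl => exact .refl
    | @head w x hwx hxt ih =>
      exact (ih ((hG.reachable_iff_reaches ht hvt).2 hxt)).head
        (show (component G v).Adj ⟨w, hwr⟩ ⟨x, _⟩ from hwx)
  refine ⟨⟨hF.dag, ?_⟩, fun w => ⟨fun hw => ?_, ?_⟩, fun k l _ => hlift l⟩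
  · have : Nonempty {w // (skeleton G).Reachable v w} := ⟨⟨t, h⟩⟩
    exact ⟨⟨fun a b => (reachable_of_reaches (hlift a)).trans
      (reachable_of_reaches (hlift b)).symm⟩, hF.acyclic⟩
  · exact (hw.eq_of_reaches (hlift w)).symm
  · rintro rfl w hw
    exact ht _ hw

theorem IsForest.deleteEdge_eq_cut {G : Digraph V} (hG : IsForest G) (e : Edge G) :
    deleteEdge G e.1 = BayesNet.cut G e.1.1 := by
  ext u v
  refine and_congr_right fun huv => not_congr ⟨fun h => congrArg Prod.fst h, ?_⟩
  rintro rfl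
  exact Prod.ext rfl (hG.rightUnique huv e.2)

theorem IsDownwardTree.reaches {G : Digraph V} [Finite V] {s : V} (hG : IsDownwardTree G s)
    (v : V) : ReflTransGen G.Adj v s := by
  obtain ⟨t, ht, hvt⟩ := hG.isForest.exists_sink v
  rwa [(hG.isSink_iff t).1 ht] at hvt

/-- Deleting `k → l` makes `k` a second sink beside `s`. Every vertex reaches exactly one of them,
so there are two components, and leading coefficients multiply. -/
theorem IsDownwardTree.components_deleteEdge [Finite V] [LinearOrder V] {T : Digraph V} {s : V}
    (hT : IsDownwardTree T s) (e : Edge T) :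
    IsDownwardTree (component (deleteEdge T e.1) e.1.1) ⟨e.1.1, SimpleGraph.Reachable.refl _⟩ ∧
    (∃ hs : (skeleton (deleteEdge T e.1)).Reachable e.1.2 s,
      IsDownwardTree (component (deleteEdge T e.1) e.1.2) ⟨s, hs⟩) ∧
    HilbertDegree.degree (bayesIdeal (deleteEdge T e.1)) =
      HilbertDegree.degree (bayesIdeal (component (deleteEdge T e.1) e.1.1)) *
      HilbertDegree.degree (bayesIdeal (component (deleteEdge T e.1) e.1.2)) := by
  classical
  have := Fintype.ofFinite V
  have hF := hT.isForest
  obtain ⟨⟨k, l⟩, hkl⟩ := e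
  have hcut := hF.deleteEdge_eq_cut ⟨(k, l), hkl⟩
  simp only at hcut hkl ⊢
  set G := deleteEdge T (k, l) with hGdef
  have hle : ∀ u v, G.Adj u v → T.Adj u v := fun u v h => h.1
  have hG : IsForest G := hF.of_le hle
  have hsink (v : V) : IsSink G v ↔ v = s ∨ v = k := by
    rw [hcut, isSink_cut_iff, hT.isSink_iff]
  have hks : k ≠ s := fun h => (hT.isSink_iff k).2 h l hkl
  have hor (w : V) : ReflTransGen G.Adj w s ∨ ReflTransGen G.Adj w k := by
    obtain ⟨t, ht, hwt⟩ := hG.exists_sink w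
    rcases (hsink t).1 ht with rfl | rfl
    exacts [Or.inl hwt, Or.inr hwt]
  have hk : IsSink G k := (hsink k).2 (Or.inr rfl)
  have hs : IsSink G s := (hsink s).2 (Or.inl rfl)
  have hls : ReflTransGen G.Adj l s :=
    (hor l).resolve_right fun h => hF.not_reaches_of_adj hkl (ReflTransGen.mono hle _ _ h)
  have hq (w : V) : (skeleton G).Reachable l w ↔ ¬ (skeleton G).Reachable k w := by
    rw [hG.reachable_iff_reaches hs hls, hG.reachable_iff_reaches hk .refl]
    refine ⟨fun h h' => ?_, fun h => (hor w).resolve_right h⟩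
    rcases ReflTransGen.total_of_right_unique hG.rightUnique h h' with h | h
    · exact hks (hs.eq_of_reaches h)
    · exact hks (hk.eq_of_reaches h).symm
  have hp (u v : V) (h : G.Adj u v) :
      (skeleton G).Reachable k u ↔ (skeleton G).Reachable k v := by
    have := reachable_of_reaches (ReflTransGen.single h)
    exact ⟨fun h => h.trans this, fun h => h.trans this.symm⟩
  refine ⟨hG.isDownwardTree_component hk .refl _, ⟨reachable_of_reaches hls,
    hG.isDownwardTree_component hs hls _⟩, ?_⟩
  have h1 := (hG.restrict fun w => (skeleton G).Reachable k w).degree_spec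
  have h2 := (hG.restrict fun w => (skeleton G).Reachable l w).degree_spec
  have hmul := h1.2.mul h2.2
  rw [← hG.flowSeries_eq_mul hq hp] at hmul
  exact hG.degree_eq_of_hasPole (mul_pos h1.1 h2.1).ne' hmul

theorem IsForest.sum_walkEdges [Fintype V] {G : Digraph V} (hG : IsForest G) (i t : V)
    (f : V → ℤ) : ∑ e ∈ walkEdges G i t, f e.1.1 = ∑ k ∈ walkTails G i t, f k := by
  classical
  refine Finset.sum_bij (fun e _ => e.1.1) (fun e he => ?_) (fun e _ e' _ h => ?_)
    (fun k hk => ?_) fun _ _ => rfl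
  · rw [mem_walkEdges] at he
    simpa [walkTails] using ⟨he.1, TransGen.head' e.2 he.2⟩
  · have he := e.2
    rw [h] at he
    exact Subtype.ext (Prod.ext h (hG.rightUnique he e'.2))
  · simp only [walkTails, Finset.mem_filter, Finset.mem_univ, true_and] at hk
    obtain ⟨x, hx, hxt⟩ := TransGen.head'_iff.1 hk.2
    exact ⟨⟨(k, x), hx⟩, mem_walkEdges.2 ⟨hk.1, hxt⟩, rfl⟩

theorem IsDownwardTree.degree_eq_sum [Finite V] [LinearOrder V] {T : Digraph V} {s : V}
    (hT : IsDownwardTree T s) {i : V} (hi : IsLeaf T i) :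
    HilbertDegree.degree (bayesIdeal T) =
      ∑ e ∈ walkEdges T i s, HilbertDegree.degree (bayesIdeal (deleteEdge T e.1)) := by
  classical
  have := Fintype.ofFinite V
  have hF := hT.isForest
  have hs : IsSink T s := (hT.isSink_iff s).2 rfl
  have hit : TransGen T.Adj i s := by
    refine (reflTransGen_iff_eq_or_transGen.1 (hT.reaches i)).resolve_left ?_
    rintro rfl
    -- A leaf has an incident edge, so it cannot be both a source and the sink.
    obtain ⟨k, hk, -⟩ := hi.2
    rcases (skeleton_adj.1 hk).2 with h | h
    exacts [hs k h, hi.1 k h]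
  simp only [hF.deleteEdge_eq_cut]
  rw [hF.sum_walkEdges i s fun k => HilbertDegree.degree (bayesIdeal (BayesNet.cut T k))]
  refine hF.degree_eq_of_hasPole (Finset.sum_pos (fun k _ => (hF.cut k).degree_spec.1)
    ⟨i, by simp [walkTails, hit, ReflTransGen.refl]⟩).ne'
    (hF.hasPole_flowSeries hi.1 hs hit _ fun k _ => (hF.cut k).degree_spec.2)

theorem IsDownwardTree.degree_eq_one [Finite V] [LinearOrder V] [Subsingleton V] {T : Digraph V}
    {s : V} (hT : IsDownwardTree T s) : HilbertDegree.degree (bayesIdeal T) = 1 := by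
  classical
  have := Fintype.ofFinite V
  refine hT.isForest.degree_eq_of_hasPole one_ne_zero (hasPole_flowSeries_of_tailCard_eq_zero ?_)
  rw [tailCard, Finset.card_eq_zero, Finset.filter_eq_empty_iff]
  intro v _
  rw [not_not, hT.isSink_iff]
  exact Subsingleton.elim v s

end BayesNet

end

/-! ### The degree recursion for downward directed trees. -/

theorem mainTheorem10 {V : Type*} [Finite V] [LinearOrder V] (T : Digraph V) (s : V)
    (hT : BayesNet.IsDownwardTree T s) :
    HilbertDegree.HasDegree (BayesNet.bayesIdeal T)
        (HilbertDegree.degree (BayesNet.bayesIdeal T)) ∧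
      (Subsingleton V → HilbertDegree.degree (BayesNet.bayesIdeal T) = 1) ∧
      ∀ i : V, BayesNet.IsLeaf T i →
        ∃ P : BayesNet.Trek T i s, (∀ P' : BayesNet.Trek T i s, P' = P) ∧
          HilbertDegree.degree (BayesNet.bayesIdeal T) =
            ∑ e ∈ P.edges,
              HilbertDegree.degree (BayesNet.bayesIdeal (BayesNet.deleteEdge T e.1)) ∧
          ∀ e ∈ P.edges,
            BayesNet.IsDownwardTree (BayesNet.component (BayesNet.deleteEdge T e.1) e.1.1)
              ⟨e.1.1, SimpleGraph.Reachable.refl _⟩ ∧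
            (∃ hs : (BayesNet.skeleton (BayesNet.deleteEdge T e.1)).Reachable e.1.2 s,
              BayesNet.IsDownwardTree (BayesNet.component (BayesNet.deleteEdge T e.1) e.1.2)
                ⟨s, hs⟩) ∧
            HilbertDegree.degree (BayesNet.bayesIdeal (BayesNet.deleteEdge T e.1)) =
              HilbertDegree.degree (BayesNet.bayesIdeal
                (BayesNet.component (BayesNet.deleteEdge T e.1) e.1.1)) *
              HilbertDegree.degree (BayesNet.bayesIdeal
                (BayesNet.component (BayesNet.deleteEdge T e.1) e.1.2)) := by
  have := Fintype.ofFinite V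
  have hF := hT.isForest
  refine ⟨hF.hasDegree, fun _ => hT.degree_eq_one, fun i hi => ?_⟩
  obtain ⟨p, hp⟩ := hF.exists_traces (hT.reaches i)
  obtain ⟨P, hP, -⟩ := hF.exists_trek_of_traces (hT.reaches i) hp
  refine ⟨P, fun P' => (hF.subsingleton_trek i s).elim P' P, ?_,
    fun e _ => hT.components_deleteEdge e⟩
  rw [hP]
  exact hT.degree_eq_sum hi
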